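/- Let $(M,\theta,g_\theta,J)$ be a Sasakian sub-Riemannian $3$-manifold: $M$ is a smooth $3$-manifold with a smooth $1$-form $\theta$, a smooth vector field $T$ with $\theta(T)=1$ and $d\theta(T,\cdot)=0$ (the Reeb field), where $d\theta(U,V)=U(\theta(V))-V(\theta(U))-\theta([U,V])$, and a smooth endomorphism field $J$ of $TM$ with $JT=0$ that maps $\ker\theta$ to itself and satisfies $J^2=-\mathrm{Id}$ there, such that $g_\theta=\tfrac12 d\theta(\cdot,J\cdot)+\theta\otimes\theta$ is a Riemannian metric (so $\theta$ is a contact form). The Tanaka connection $\nabla$, with torsion $T_\nabla(U,V)=\nabla_UV-\nabla_VU-[U,V]$, is the unique linear connection with $\nabla\theta=0$, $\nabla T=0$, $\nabla g_\theta=0$, $T_\nabla(U,V)=d\theta(U,V)\,T$ for $U,V\in\ker\theta$, and $T_\nabla(T,JU)=-J\,T_\nabla(T,U)$ for all $U$; "Sasakian" means that $\nabla J=0$ and $T_\nabla(T,\cdot)=0$. Let $a<b$, $u_0\in[a,b]$, $T_0>0$. Let $\gamma_0:[a,b]\to M$ be a Legendrian curve, i.e. $\theta(\gamma_0')=0$ (a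 closed curve, parametrized over one period, is included), and let $\gamma:[a,b]\times[0,T_0)\to M$ be a smooth solution of the Legendrian curve expanding flow $$\frac{\partial\gamma}{\partial t}=-k^{-1}J\dot\gamma-2\Big(\int_0^s k^{-1}\,ds\Big)T,\qquad \gamma(\cdot,0)=\gamma_0 .$$ Here each $\gamma(\cdot,t)$ is an immersed curve, $ds=|\gamma'(u,t)|\,du$ with $\gamma'=\partial\gamma/\partial u$ and $|\cdot|$ the norm of $g_\theta$, the arc length $s$ is measured from the parameter $u_0$, $\dot\gamma=\gamma'/|\gamma'|$ is the unit tangent, $k=g_\theta(\nabla_{\dot\gamma}\dot\gamma,J\dot\gamma)$ is the curvature, and $k\neq0$ everywhere. Then the length $\mathcal L_t=\int_a^b|\gamma'(u,t)|\,du$ of $\gamma(\cdot,t)$ is positive and differentiable in $t$ (from the right at $t=0$), and for all $t\in[0,T_0)$ $$\frac{d}{dt}\mathcal L_t=\mathcal L_t,\qquad\text{hence}\qquad \mathcal L_t=e^t\mathcal L_0 .$$ In particular the length increases exponentially along the flow. -/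

import Mathlib

open Set Bundle
open scoped Manifold ContDiff

noncomputable section

/-- The model space of a `3`-manifold. -/
abbrev E3 : Type := EuclideanSpace ℝ (Fin 3)

/-! ### Sasakian sub-Riemannian 3-manifolds -/

section Sasakian

variable {M : Type*} [TopologicalSpace M] [ChartedSpace E3 M] [IsManifold (𝓡 3) ∞ M]

/-- A vector field on `M`, with no regularity. -/
abbrev VField (M : Type*) [TopologicalSpace M] [ChartedSpace E3 M] : Type _ :=
  (x : M) → TangentSpace (𝓡 3) x

/-- The vector field `U` is differentiable at `x`, as a section of `TM`. -/
def VField.DiffAt (U : VField M) (x : M) : Prop :=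
  MDifferentiableAt (𝓡 3) ((𝓡 3).prod 𝓘(ℝ, E3)) (fun y ↦ TotalSpace.mk' E3 y (U y)) x

/-- The exterior derivative of a `1`-form at a point,
`dθ(U, V) = U(θ(V)) - V(θ(U)) - θ([U, V])`. It depends only on the values of `U` and `V` at the
point when `θ` is differentiable; `U` and `V` are extensions of the given tangent vectors. -/
def dForm (θ : (x : M) → TangentSpace (𝓡 3) x →L[ℝ] ℝ) (x : M) (u v : TangentSpace (𝓡 3) x) : ℝ :=
  let U : VField M := FiberBundle.extend E3 u
  let V : VField M := FiberBundle.extend E3 v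
  mvfderiv (𝓡 3) (fun y ↦ θ y (V y)) x u - mvfderiv (𝓡 3) (fun y ↦ θ y (U y)) x v
    - θ x (VectorField.mlieBracket (𝓡 3) U V x)

variable (M) in
/-- A contact sub-Riemannian (contact metric) `3`-manifold `(M, θ, g)`: a contact form `θ` with
horizontal distribution `ker θ`, its Reeb field `T`, the complex structure `J` on `ker θ` extended
by `J T = 0`, and the Riemannian metric `g_θ = dθ(·, J ·) / 2 + θ ⊗ θ`.

Since `dθ(e, J e) = 2 g(e, e) > 0` for horizontal `e ≠ 0`, the `3`-form `θ ∧ dθ` vanishes nowhere,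
and `J` is the rotation by `90°` of `ker θ` which is positive for the orientation of `θ ∧ dθ`. -/
structure ContactSubRiemannian where
  /-- the contact form -/
  θ : (x : M) → TangentSpace (𝓡 3) x →L[ℝ] ℝ
  /-- the Reeb vector field -/
  T : VField M
  /-- the complex structure -/
  J : (x : M) → TangentSpace (𝓡 3) x →L[ℝ] TangentSpace (𝓡 3) x
  /-- the Riemannian metric `g_θ` -/
  g : ContMDiffRiemannianMetric (𝓡 3) ∞ E3 (fun x : M ↦ TangentSpace (𝓡 3) x)
  smooth_θ : ContMDiff (𝓡 3) ((𝓡 3).prod 𝓘(ℝ, E3 →L[ℝ] ℝ)) ∞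
    (fun x ↦ TotalSpace.mk' (E3 →L[ℝ] ℝ) x (θ x) :
      M → TotalSpace (E3 →L[ℝ] ℝ) (fun x : M ↦ TangentSpace (𝓡 3) x →L[ℝ] Bundle.Trivial M ℝ x))
  smooth_T : ContMDiff (𝓡 3) ((𝓡 3).prod 𝓘(ℝ, E3)) ∞ (fun x ↦ TotalSpace.mk' E3 x (T x))
  smooth_J : ContMDiff (𝓡 3) ((𝓡 3).prod 𝓘(ℝ, E3 →L[ℝ] E3)) ∞
    (fun x ↦ TotalSpace.mk' (E3 →L[ℝ] E3) x (J x) :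
      M → TotalSpace (E3 →L[ℝ] E3)
        (fun x : M ↦ TangentSpace (𝓡 3) x →L[ℝ] TangentSpace (𝓡 3) x))
  θ_T : ∀ x, θ x (T x) = 1
  dθ_T : ∀ x u, dForm θ x (T x) u = 0
  J_T : ∀ x, J x (T x) = 0
  θ_J : ∀ x u, θ x u = 0 → θ x (J x u) = 0
  J_J : ∀ x u, θ x u = 0 → J x (J x u) = -u
  g_eq : ∀ x u v, g.inner x u v = 1 / 2 * dForm θ x u (J x v) + θ x u * θ x v

variable (S : ContactSubRiemannian M)
  (nabla : CovariantDerivative (𝓡 3) E3 (fun x : M ↦ TangentSpace (𝓡 3) x))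

/-- `nabla` is the Tanaka connection `∇` of the contact sub-Riemannian manifold, that is, the
unique linear connection with the properties below. In Mathlib's argument order,
`nabla U x v` is `∇_v U` at `x`, and `nabla.torsion x u v` is
`∇_U V - ∇_V U - [U, V]` at `x`, where `U` and `V` extend `u` and `v`. -/
structure IsTanakaConnection : Prop where
  /-- `∇ θ = 0` -/
  parallel_θ : ∀ (U : VField M) (x : M) (v : TangentSpace (𝓡 3) x), U.DiffAt x →
    mvfderiv (𝓡 3) (fun y ↦ S.θ y (U y)) x v = S.θ x (nabla U x v)
  /-- `∇ T = 0` -/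
  parallel_T : ∀ (x : M) (v : TangentSpace (𝓡 3) x), nabla S.T x v = 0
  /-- `∇ g_θ = 0` -/
  parallel_g : ∀ (U V : VField M) (x : M) (w : TangentSpace (𝓡 3) x), U.DiffAt x → V.DiffAt x →
    mvfderiv (𝓡 3) (fun y ↦ S.g.inner y (U y) (V y)) x w
      = S.g.inner x (nabla U x w) (V x) + S.g.inner x (U x) (nabla V x w)
  /-- `T_∇(U, V) = dθ(U, V) T` for horizontal `U`, `V` -/
  torsion_horizontal : ∀ (x : M) (u v : TangentSpace (𝓡 3) x), S.θ x u = 0 → S.θ x v = 0 →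
    nabla.torsion x u v = dForm S.θ x u v • S.T x
  /-- `T_∇(T, J U) = -J T_∇(T, U)` -/
  torsion_J : ∀ (x : M) (u : TangentSpace (𝓡 3) x),
    nabla.torsion x (S.T x) (S.J x u) = -S.J x (nabla.torsion x (S.T x) u)

/-- The contact sub-Riemannian manifold with Tanaka connection `∇` is Sasakian: the tensor
`Q(U, V) = (∇_V J) U` and the torsion operator `σ(U) = T_∇(T, U)` vanish. -/
structure IsSasakian : Prop where
  parallel_J : ∀ (U : VField M) (x : M) (v : TangentSpace (𝓡 3) x), U.DiffAt x →
    nabla (fun y ↦ S.J y (U y)) x v - S.J x (nabla U x v) = 0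
  torsion_T : ∀ (x : M) (u : TangentSpace (𝓡 3) x), nabla.torsion x (S.T x) u = 0

/-! ### Curves. A curve is a map `c : ℝ → M` considered on an interval `s`; derivatives are taken
within `s`, hence are one-sided at the end points of `s`. -/

/-- The velocity `c'(u)` of the curve `c`. -/
def velocity (c : ℝ → M) (s : Set ℝ) (u : ℝ) : TangentSpace (𝓡 3) (c u) :=
  mfderivWithin 𝓘(ℝ) (𝓡 3) c s u (1 : ℝ)

/-- The covariant derivative `∇_u V` at the parameter `u` of a vector field `V` along the curve `c`.
In the chart at `x = c u` one has `∇_u V = (V^j)' ∂_j + V^j ∇_{c'(u)} ∂_j`. The second summand is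
`∇_{c'(u)} Ṽ` for the field `Ṽ` extending `V u` with constant coordinates near `x`. -/
def covAlong (c : ℝ → M) (s : Set ℝ) (V : (u : ℝ) → TangentSpace (𝓡 3) (c u)) (u : ℝ) :
    TangentSpace (𝓡 3) (c u) :=
  let triv := trivializationAt E3 (fun x : M ↦ TangentSpace (𝓡 3) x) (c u)
  triv.symm (c u) (derivWithin (fun w ↦ (triv (TotalSpace.mk' E3 (c w) (V w))).2) s u)
    + nabla (FiberBundle.extend E3 (V u)) (c u) (velocity c s u)

/-- The speed `|c'(u)|` with respect to `g_θ`. -/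
def speed (c : ℝ → M) (s : Set ℝ) (u : ℝ) : ℝ :=
  √(S.g.inner (c u) (velocity c s u) (velocity c s u))

/-- The unit tangent vector `ċ = c' / |c'|`. -/
def unitTangent (c : ℝ → M) (s : Set ℝ) (u : ℝ) : TangentSpace (𝓡 3) (c u) :=
  (speed S c s u)⁻¹ • velocity c s u

/-- The curvature `k = g_θ(∇_ċ ċ, J ċ)`, where `∇_ċ = |c'|⁻¹ ∇_u`. -/
def curvature (c : ℝ → M) (s : Set ℝ) (u : ℝ) : ℝ :=
  S.g.inner (c u) ((speed S c s u)⁻¹ • covAlong nabla c s (unitTangent S c s) u)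
    (S.J (c u) (unitTangent S c s u))

/-- The length of the curve `c` on `[a, b]`. -/
def curveLength (c : ℝ → M) (a b : ℝ) : ℝ :=
  ∫ u in a..b, speed S c (Icc a b) u

/-- The curve `c` on `s` is Legendrian: it is tangent to `ker θ`. -/
def IsLegendrian (c : ℝ → M) (s : Set ℝ) : Prop :=
  ∀ u ∈ s, S.θ (c u) (velocity c s u) = 0

/-- `γ`, `(u, t) ↦ γ u t`, is a smooth solution on `[a, b] × [0, T₀)` of the flow
`∂γ/∂t = -k⁻¹ J γ̇ - 2 (∫₀ˢ k⁻¹ ds) T`, `γ(·, 0) = γ₀`, where the arc length `s` of `γ(·, t)` is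
measured from the parameter `u₀`, so that `ds = |γ'| du`. -/
structure IsExpandingFlow (γ : ℝ → ℝ → M) (γ₀ : ℝ → M) (a b u₀ T₀ : ℝ) : Prop where
  smooth : ContMDiffOn 𝓘(ℝ, ℝ × ℝ) (𝓡 3) ∞ (fun p : ℝ × ℝ ↦ γ p.1 p.2) (Icc a b ×ˢ Ico 0 T₀)
  immersed : ∀ t ∈ Ico 0 T₀, ∀ u ∈ Icc a b, velocity (fun w ↦ γ w t) (Icc a b) u ≠ 0
  curvature_ne_zero : ∀ t ∈ Ico 0 T₀, ∀ u ∈ Icc a b,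
    curvature S nabla (fun w ↦ γ w t) (Icc a b) u ≠ 0
  equation : ∀ t ∈ Ico 0 T₀, ∀ u ∈ Icc a b,
    velocity (fun r ↦ γ u r) (Ico 0 T₀) t
      = -(curvature S nabla (fun w ↦ γ w t) (Icc a b) u)⁻¹ •
          S.J (γ u t) (unitTangent S (fun w ↦ γ w t) (Icc a b) u)
        - (2 * ∫ w in u₀..u, (curvature S nabla (fun w ↦ γ w t) (Icc a b) w)⁻¹
            * speed S (fun w ↦ γ w t) (Icc a b) w) • S.T (γ u t)
  initial : ∀ u ∈ Icc a b, γ u 0 = γ₀ u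

end Sasakian

end

/-! ### Pointwise algebra of `θ`, `J`, `g` and the torsion -/

section ContactAlgebra

variable {M : Type*} [TopologicalSpace M] [ChartedSpace E3 M] [IsManifold (𝓡 3) ∞ M]

/-! Write X = ∂γ/∂u, Y = ∂γ/∂t and τ = X/|X|. The speed already satisfies |X|(u,t) = eᵗ |X|(u,0) for
each fixed u, so the length is obtained by integrating in u, without differentiating under the
integral sign.

Mixed derivatives commute up to torsion: ∇_t X = ∇_u Y + T_∇(Y, X) (`covAlong_sub_covAlong`). Since
T_∇(T, ·) = 0 and the torsion of horizontal vectors is vertical, the flow equation gives T_∇(Y, X) =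
2k⁻¹|X|⁻¹|JX|² T.

The flow preserves Legendrian curves (`θ_fstVelocity`). From θ(Y) = -2∫k⁻¹ds and ∇θ = 0 one gets
θ(∇_u Y) = -2k⁻¹|X|, and |JX|² = |X|² - θ(X)². The |X| terms cancel, leaving ∂_t θ(X) = -2k⁻¹|X|⁻¹
θ(X)². With one factor θ(X) absorbed into a continuous coefficient, this is a linear equation with
zero initial value, so θ(X) = 0.

Now the torsion is orthogonal to X, so ∂_t|X|² = 2g(∇_u Y, X). Differentiating g(Y, τ) = 0 in u
gives g(∇_u Y, τ) = -g(Y, ∇_u τ) = k⁻¹g(Jτ, ∇_u τ) = |X|; the vertical part of Y drops out because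
∇_u τ is horizontal. Hence ∂_t|X|² = 2|X|². -/

theorem dForm_antisymm (θ : (x : M) → TangentSpace (𝓡 3) x →L[ℝ] ℝ) (x : M)
    (u v : TangentSpace (𝓡 3) x) : dForm θ x u v = -dForm θ x v u := by
  simp only [dForm]
  rw [VectorField.mlieBracket_swap]
  simp only [Pi.neg_apply, map_neg]
  ring

namespace ContactSubRiemannian

variable (S : ContactSubRiemannian M) {x : M}

theorem inner_T (u : TangentSpace (𝓡 3) x) : S.g.inner x u (S.T x) = S.θ x u := by
  -- Taking v = 0 yields dθ(u, 0) = 0, which is the term dθ(u, JT) left by v = T.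
  have h0 := S.g_eq x u 0
  have h1 := S.g_eq x u (S.T x)
  simp only [map_zero, S.J_T, S.θ_T] at h0 h1
  linarith

theorem inner_T_left (u : TangentSpace (𝓡 3) x) : S.g.inner x (S.T x) u = S.θ x u := by
  rw [S.g.symm, S.inner_T]

theorem dForm_J (u v : TangentSpace (𝓡 3) x) :
    dForm S.θ x u (S.J x v) = 2 * S.g.inner x u v - 2 * S.θ x u * S.θ x v := by
  have := S.g_eq x u v
  linarith

/-- The horizontal part `u - θ(u) T` of a tangent vector. -/
noncomputable def horizontal (u : TangentSpace (𝓡 3) x) : TangentSpace (𝓡 3) x := u - S.θ x u • S.T x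

theorem θ_horizontal (u : TangentSpace (𝓡 3) x) : S.θ x (S.horizontal u) = 0 := by
  simp [horizontal, S.θ_T]

theorem J_horizontal (u : TangentSpace (𝓡 3) x) : S.J x (S.horizontal u) = S.J x u := by
  simp [horizontal, S.J_T]

theorem θ_J_apply (u : TangentSpace (𝓡 3) x) : S.θ x (S.J x u) = 0 := by
  rw [← S.J_horizontal]
  exact S.θ_J x _ (S.θ_horizontal u)

/-- Twice this inner product is dθ(Ju, Ju), which vanishes by antisymmetry. -/
theorem inner_J_self_of_horizontal {u : TangentSpace (𝓡 3) x} (hu : S.θ x u = 0) :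
    S.g.inner x (S.J x u) u = 0 := by
  have h := S.dForm_J (S.J x u) u
  have h' := dForm_antisymm S.θ x (S.J x u) (S.J x u)
  rw [hu] at h
  linarith

theorem dForm_J_left {u v : TangentSpace (𝓡 3) x} (hv : S.θ x v = 0) :
    dForm S.θ x (S.J x u) v = -2 * S.g.inner x (S.J x u) (S.J x v) := by
  -- J(-Jv) = v for horizontal v, so any horizontal second argument has the form required by
  -- `dForm_J`.
  have h := S.dForm_J (S.J x u) (-S.J x v)
  rw [map_neg, S.J_J x v hv, neg_neg, map_neg, map_neg, S.θ_J_apply] at h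
  linarith

/-- Both sides are, up to the factor 2 and sign, values of dθ on the pair u, Ju. -/
theorem inner_J_J_of_horizontal {u : TangentSpace (𝓡 3) x} (hu : S.θ x u = 0) :
    S.g.inner x (S.J x u) (S.J x u) = S.g.inner x u u := by
  have h1 := S.dForm_J_left (u := u) hu
  have h2 := S.dForm_J u u
  have h3 := dForm_antisymm S.θ x (S.J x u) u
  rw [hu] at h2
  linarith

theorem inner_J_J_self (u : TangentSpace (𝓡 3) x) :
    S.g.inner x (S.J x u) (S.J x u) = S.g.inner x u u - S.θ x u ^ 2 := by
  rw [← S.J_horizontal, S.inner_J_J_of_horizontal (S.θ_horizontal u)]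
  simp only [horizontal, map_sub, map_smul, sub_apply, smul_apply,
    S.inner_T, S.inner_T_left, S.θ_T, smul_eq_mul]
  ring

theorem inner_self_pos {u : TangentSpace (𝓡 3) x} (hu : u ≠ 0) : 0 < S.g.inner x u u :=
  S.g.pos x u hu

end ContactSubRiemannian

variable {S : ContactSubRiemannian M}
  {nabla : CovariantDerivative (𝓡 3) E3 (fun x : M ↦ TangentSpace (𝓡 3) x)}

/-- On a Sasakian manifold the torsion of `J u` and `v` is vertical. -/
theorem torsion_J_left (hnabla : IsTanakaConnection S nabla) (hS : IsSasakian S nabla) {x : M}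
    (u v : TangentSpace (𝓡 3) x) :
    nabla.torsion x (S.J x u) v = (-2 * S.g.inner x (S.J x u) (S.J x v)) • S.T x := by
  -- Only the horizontal part of v contributes: the Sasakian condition kills the torsion against T.
  have hv : v = S.horizontal v + S.θ x v • S.T x := by simp [ContactSubRiemannian.horizontal]
  have hT : nabla.torsion x (S.J x u) (S.T x) = 0 := by
    rw [nabla.torsion_antisymm, hS.torsion_T, neg_zero]
  conv_lhs => rw [hv]
  rw [map_add, map_smul, hT, smul_zero, add_zero,
    hnabla.torsion_horizontal x _ _ (S.θ_J_apply u) (S.θ_horizontal v),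
    S.dForm_J_left (S.θ_horizontal v), S.J_horizontal]

end ContactAlgebra

/-! ### Product rule for operator-valued curves -/

theorem DifferentiableWithinAt.of_clm_apply {E F : Type*} [NormedAddCommGroup E] [NormedSpace ℝ E]
    [FiniteDimensional ℝ E] [NormedAddCommGroup F] [NormedSpace ℝ F] {h : ℝ → E →L[ℝ] F}
    {s : Set ℝ} {u : ℝ} (H : ∀ e, DifferentiableWithinAt ℝ (fun w ↦ h w e) s u) :
    DifferentiableWithinAt ℝ h s u := by
  let b := Module.finBasis ℝ E
  let p (i) : E →L[ℝ] ℝ := LinearMap.toContinuousLinearMap (b.coord i)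
  have key : h = fun w ↦ ∑ i, (p i).smulRight (h w (b i)) := by
    ext w e
    conv_lhs => rw [← b.sum_repr e, map_sum]
    simp [p]
  rw [key]
  refine DifferentiableWithinAt.fun_sum fun i _ ↦ ?_
  exact (ContinuousLinearMap.smulRightL ℝ E F (p i)).differentiableAt.comp_differentiableWithinAt u
    (H (b i))

/-- Here d measures the variation of the operators on the frozen vector `v u`. This is the shape of
`covAlong`: a connection term on a frozen extension plus a coordinate derivative. -/
theorem HasDerivWithinAt.clm_apply_of_apply {E F : Type*} [NormedAddCommGroup E] [NormedSpace ℝ E]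
    [FiniteDimensional ℝ E] [NormedAddCommGroup F] [NormedSpace ℝ F] {h : ℝ → E →L[ℝ] F}
    {s : Set ℝ} {u : ℝ} {v : ℝ → E} {v' : E} {d : F}
    (H : ∀ e, DifferentiableWithinAt ℝ (fun w ↦ h w e) s u)
    (hd : HasDerivWithinAt (fun w ↦ h w (v u)) d s u) (hv : HasDerivWithinAt v v' s u) :
    HasDerivWithinAt (fun w ↦ h w (v w)) (d + h u v') s u := by
  -- The increment `v w - v u` vanishes at u, so the derivative of h drops out of this term.
  have h1 := (DifferentiableWithinAt.of_clm_apply H).hasDerivWithinAt.clm_apply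
    (hv.sub_const (v u))
  simpa [Pi.add_def] using hd.add h1

/-! ### Covariant derivative along a curve: compatibility with `θ` and `g` -/

section CovAlong

variable {M : Type*} [TopologicalSpace M] [ChartedSpace E3 M] [IsManifold (𝓡 3) ∞ M]

omit [IsManifold (𝓡 3) ∞ M] in
theorem hasDerivWithinAt_comp_velocity {f : M → ℝ} {c : ℝ → M} {s : Set ℝ} {u : ℝ}
    (hf : MDifferentiableAt (𝓡 3) 𝓘(ℝ) f (c u))
    (hc : MDifferentiableWithinAt 𝓘(ℝ) (𝓡 3) c s u) :
    HasDerivWithinAt (fun w ↦ f (c w)) (mvfderiv (𝓡 3) f (c u) (velocity c s u)) s u := by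
  have h := (hf.hasMFDerivAt.comp_hasMFDerivWithinAt u hc.hasMFDerivWithinAt).hasFDerivWithinAt
  exact HasFDerivWithinAt.hasDerivWithinAt (f := f ∘ c) h

variable {S : ContactSubRiemannian M}
  {nabla : CovariantDerivative (𝓡 3) E3 (fun x : M ↦ TangentSpace (𝓡 3) x)}

theorem ContactSubRiemannian.mdifferentiableAt_inner {U V : VField M} {x : M} (hU : U.DiffAt x)
    (hV : V.DiffAt x) :
    MDifferentiableAt (𝓡 3) 𝓘(ℝ) (fun y ↦ S.g.inner y (U y) (V y)) x := by
  have : MDifferentiableAt (𝓡 3) ((𝓡 3).prod 𝓘(ℝ))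
      (fun m ↦ TotalSpace.mk' ℝ (E := Bundle.Trivial M ℝ) m (S.g.inner m (U m) (V m))) x := by
    refine MDifferentiableAt.clm_bundle_apply₂ (F₁ := E3) (F₂ := E3) (F₃ := ℝ)
      (E₃ := fun x ↦ Bundle.Trivial M ℝ x) (ψ := fun m ↦ S.g.inner m) (v := U) (w := V)
      (b := fun x : M ↦ x) ?_ hU hV
    exact S.g.contMDiff.mdifferentiable (by simp) x
  rw [mdifferentiableAt_totalSpace] at this
  exact this.2

theorem ContactSubRiemannian.mdifferentiableAt_θ {U : VField M} {x : M} (hU : U.DiffAt x) :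
    MDifferentiableAt (𝓡 3) 𝓘(ℝ) (fun y ↦ S.θ y (U y)) x := by
  simp only [← S.inner_T]
  exact S.mdifferentiableAt_inner hU (S.smooth_T.mdifferentiable (by simp) x)

theorem mdifferentiableWithinAt_of_lift {c : ℝ → M} {s : Set ℝ} {u : ℝ}
    {V : (u : ℝ) → TangentSpace (𝓡 3) (c u)}
    (hV : MDifferentiableWithinAt 𝓘(ℝ) ((𝓡 3).prod 𝓘(ℝ, E3))
      (fun w ↦ TotalSpace.mk' E3 (c w) (V w)) s u) :
    MDifferentiableWithinAt 𝓘(ℝ) (𝓡 3) c s u := by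
  rw [mdifferentiableWithinAt_totalSpace] at hV
  exact hV.1

theorem differentiableWithinAt_trivializationAt {c : ℝ → M} {s : Set ℝ} {u : ℝ}
    {V : (u : ℝ) → TangentSpace (𝓡 3) (c u)}
    (hV : MDifferentiableWithinAt 𝓘(ℝ) ((𝓡 3).prod 𝓘(ℝ, E3))
      (fun w ↦ TotalSpace.mk' E3 (c w) (V w)) s u) :
    DifferentiableWithinAt ℝ (fun w ↦ (trivializationAt E3 (fun x : M ↦ TangentSpace (𝓡 3) x)
        (c u) (TotalSpace.mk' E3 (c w) (V w))).2) s u := by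
  rw [mdifferentiableWithinAt_totalSpace] at hV
  exact mdifferentiableWithinAt_iff_differentiableWithinAt.1 hV.2

/-- The field with constant coordinates `e` in the chart at `x`. -/
noncomputable def constField (x : M) (e : E3) : VField M := fun y ↦
  (trivializationAt E3 (fun x : M ↦ TangentSpace (𝓡 3) x) x).symmL ℝ y e

theorem eventually_mem_baseSet {c : ℝ → M} {s : Set ℝ} {u : ℝ} (hc : ContinuousWithinAt c s u) :
    ∀ᶠ w in nhdsWithin u s,
      c w ∈ (trivializationAt E3 (fun x : M ↦ TangentSpace (𝓡 3) x) (c u)).baseSet :=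
  hc.preimage_mem_nhdsWithin ((trivializationAt E3
    (fun x : M ↦ TangentSpace (𝓡 3) x) (c u)).open_baseSet.mem_nhds
      (FiberBundle.mem_baseSet_trivializationAt' (c u)))

theorem constField_apply {x y : M} (e : E3)
    (hy : y ∈ (trivializationAt E3 (fun x : M ↦ TangentSpace (𝓡 3) x) x).baseSet) :
    constField x e y = (trivializationAt E3 (fun x : M ↦ TangentSpace (𝓡 3) x) x).symm y e :=
  Trivialization.symmL_apply (trivializationAt E3 (fun x : M ↦ TangentSpace (𝓡 3) x) x) hy e

theorem extend_eq_constField {x y : M} (e : TangentSpace (𝓡 3) x)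
    (hy : y ∈ (trivializationAt E3 (fun x : M ↦ TangentSpace (𝓡 3) x) x).baseSet) :
    (FiberBundle.extend E3 e : VField M) y =
      constField x (trivializationAt E3 (fun x : M ↦ TangentSpace (𝓡 3) x) x
        (TotalSpace.mk' E3 x e)).2 y :=
  (constField_apply _ hy).symm

theorem constField_diffAt (x : M) (e : E3) : (constField x e).DiffAt x := by
  let triv := trivializationAt E3 (fun x : M ↦ TangentSpace (𝓡 3) x) x
  have hx : x ∈ triv.baseSet := FiberBundle.mem_baseSet_trivializationAt' x
  have hd : VField.DiffAt (M := M) (FiberBundle.extend E3 (triv.symm x e)) x :=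
    FiberBundle.mdifferentiableAt_extend ..
  refine hd.congr_of_eventuallyEq ?_
  filter_upwards [triv.open_baseSet.mem_nhds hx] with y hy
  rw [extend_eq_constField _ hy, TotalSpace.mk', triv.apply_mk_symm hx]

theorem constField_trivializationAt {c : ℝ → M} {u w : ℝ}
    (V : (u : ℝ) → TangentSpace (𝓡 3) (c u))
    (hw : c w ∈ (trivializationAt E3 (fun x : M ↦ TangentSpace (𝓡 3) x) (c u)).baseSet) :
    constField (c u) (trivializationAt E3 (fun x : M ↦ TangentSpace (𝓡 3) x) (c u)
        (TotalSpace.mk' E3 (c w) (V w))).2 (c w) = V w := by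
  rw [constField_apply _ hw]
  exact Trivialization.symm_apply_apply_mk _ hw _

theorem covAlong_eq {c : ℝ → M} {s : Set ℝ} (V : (u : ℝ) → TangentSpace (𝓡 3) (c u)) (u : ℝ) :
    covAlong nabla c s V u = constField (c u) (derivWithin (fun w ↦
      (trivializationAt E3 (fun x : M ↦ TangentSpace (𝓡 3) x) (c u)
        (TotalSpace.mk' E3 (c w) (V w))).2) s u) (c u)
      + nabla (FiberBundle.extend E3 (V u)) (c u) (velocity c s u) := by
  rw [constField_apply _ (FiberBundle.mem_baseSet_trivializationAt' (c u)), covAlong]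

/-- With the coordinates of V frozen, ∇θ = 0 gives the connection term of `covAlong`; the moving
coordinates give the other term. -/
theorem hasDerivWithinAt_θ (hnabla : IsTanakaConnection S nabla) {c : ℝ → M} {s : Set ℝ} {u : ℝ}
    (hu : u ∈ s) {V : (u : ℝ) → TangentSpace (𝓡 3) (c u)}
    (hV : MDifferentiableWithinAt 𝓘(ℝ) ((𝓡 3).prod 𝓘(ℝ, E3))
      (fun w ↦ TotalSpace.mk' E3 (c w) (V w)) s u) :
    HasDerivWithinAt (fun w ↦ S.θ (c w) (V w)) (S.θ (c u) (covAlong nabla c s V u)) s u := by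
  let triv := trivializationAt E3 (fun x : M ↦ TangentSpace (𝓡 3) x) (c u)
  have hc := mdifferentiableWithinAt_of_lift hV
  have hv := (differentiableWithinAt_trivializationAt hV).hasDerivWithinAt
  have hb := eventually_mem_baseSet hc.continuousWithinAt
  have hd : VField.DiffAt (M := M) (FiberBundle.extend E3 (V u)) (c u) :=
    FiberBundle.mdifferentiableAt_extend ..
  have h1 := hasDerivWithinAt_comp_velocity (S.mdifferentiableAt_θ hd) hc
  rw [hnabla.parallel_θ _ _ _ hd] at h1
  have h2 := HasDerivWithinAt.clm_apply_of_apply (h := fun w ↦ (S.θ (c w)) ∘L triv.symmL ℝ (c w))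
    (fun e ↦ (hasDerivWithinAt_comp_velocity (S.mdifferentiableAt_θ
      (constField_diffAt (c u) e)) hc).differentiableWithinAt)
    (h1.congr_of_eventuallyEq_of_mem (hb.mono fun w hw ↦ by
      simp only [extend_eq_constField (V u) hw]; rfl) hu) hv
  rw [covAlong_eq, map_add, add_comm]
  refine h2.congr_of_eventuallyEq_of_mem (hb.mono fun w hw ↦ ?_) hu
  exact congrArg (S.θ (c w)) (constField_trivializationAt V hw).symm

theorem hasDerivWithinAt_inner (hnabla : IsTanakaConnection S nabla) {c : ℝ → M} {s : Set ℝ}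
    {u : ℝ} (hu : u ∈ s) {V W : (u : ℝ) → TangentSpace (𝓡 3) (c u)}
    (hV : MDifferentiableWithinAt 𝓘(ℝ) ((𝓡 3).prod 𝓘(ℝ, E3))
      (fun w ↦ TotalSpace.mk' E3 (c w) (V w)) s u)
    (hW : MDifferentiableWithinAt 𝓘(ℝ) ((𝓡 3).prod 𝓘(ℝ, E3))
      (fun w ↦ TotalSpace.mk' E3 (c w) (W w)) s u) :
    HasDerivWithinAt (fun w ↦ S.g.inner (c w) (V w) (W w))
      (S.g.inner (c u) (covAlong nabla c s V u) (W u)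
        + S.g.inner (c u) (V u) (covAlong nabla c s W u)) s u := by
  let triv := trivializationAt E3 (fun x : M ↦ TangentSpace (𝓡 3) x) (c u)
  have hc := mdifferentiableWithinAt_of_lift hV
  have hv := (differentiableWithinAt_trivializationAt hV).hasDerivWithinAt
  have hw := (differentiableWithinAt_trivializationAt hW).hasDerivWithinAt
  have hb := eventually_mem_baseSet hc.continuousWithinAt
  have hdV : VField.DiffAt (M := M) (FiberBundle.extend E3 (V u)) (c u) :=
    FiberBundle.mdifferentiableAt_extend ..
  have hdW : VField.DiffAt (M := M) (FiberBundle.extend E3 (W u)) (c u) :=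
    FiberBundle.mdifferentiableAt_extend ..
  have h1 := hasDerivWithinAt_comp_velocity (S.mdifferentiableAt_inner hdV hdW) hc
  rw [hnabla.parallel_g _ _ _ _ hdV hdW] at h1
  simp only [FiberBundle.extend_apply_self] at h1
  -- The metric along c in the trivialization at `c u`. The product rule is applied to it twice:
  -- first W moves with V frozen, then V moves too.
  let B (w : ℝ) : E3 →L[ℝ] E3 →L[ℝ] ℝ :=
    (triv.symmL ℝ (c w)).precomp ℝ ∘L S.g.inner (c w) ∘L triv.symmL ℝ (c w)
  have hB (e e' : E3) : DifferentiableWithinAt ℝ (fun w ↦ B w e e') s u :=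
    (hasDerivWithinAt_comp_velocity (S.mdifferentiableAt_inner
      (constField_diffAt (c u) e) (constField_diffAt (c u) e')) hc).differentiableWithinAt
  have h2 := HasDerivWithinAt.clm_apply_of_apply (h := fun w ↦ B w _) (hB _)
    (h1.congr_of_eventuallyEq_of_mem (hb.mono fun w hw ↦ by
      simp only [extend_eq_constField _ hw]; rfl) hu) hw
  have h3 := HasDerivWithinAt.clm_apply_of_apply (h := fun w ↦ (B w).flip _)
    (fun e ↦ (HasDerivWithinAt.clm_apply_of_apply (h := fun w ↦ B w e) (hB e)
      (hB e _).hasDerivWithinAt hw).differentiableWithinAt) h2 hv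
  rw [covAlong_eq, covAlong_eq]
  simp only [map_add, add_apply]
  refine (h3.congr_of_eventuallyEq_of_mem (hb.mono fun w hw ↦ ?_) hu).congr_deriv ?_
  · have e1 := constField_trivializationAt V hw
    have e2 := constField_trivializationAt W hw
    conv_lhs => rw [← e1, ← e2]
    rfl
  · have e1 := constField_trivializationAt V
      (FiberBundle.mem_baseSet_trivializationAt' (F := E3)
        (E := fun x : M ↦ TangentSpace (𝓡 3) x) (c u))
    have e2 := constField_trivializationAt W
      (FiberBundle.mem_baseSet_trivializationAt' (F := E3)
        (E := fun x : M ↦ TangentSpace (𝓡 3) x) (c u))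
    have k1 (z : E3) := congrArg (fun q ↦ S.g.inner (c u) q (constField (c u) z (c u))) e1
    have k2 (z : E3) := congrArg (fun q ↦ S.g.inner (c u) (constField (c u) z (c u)) q) e2
    rw [← k1, ← k2]
    exact (show ∀ p q r t : ℝ, p + q + r + t = t + p + (r + q) from fun _ _ _ _ ↦ by ring) _ _ _ _

end CovAlong

/-! ### Smooth vector fields along a map into `M` -/

section Lifts

variable {M : Type*} [TopologicalSpace M] [ChartedSpace E3 M] [IsManifold (𝓡 3) ∞ M]
  {E : Type*} [NormedAddCommGroup E] [NormedSpace ℝ E] {Γ : E → M} {D : Set E}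
  (S : ContactSubRiemannian M)

theorem ContMDiffOn.of_lift {V : (p : E) → TangentSpace (𝓡 3) (Γ p)}
    (hV : ContMDiffOn 𝓘(ℝ, E) ((𝓡 3).prod 𝓘(ℝ, E3)) ∞ (fun p ↦ TotalSpace.mk' E3 (Γ p) (V p)) D) :
    ContMDiffOn 𝓘(ℝ, E) (𝓡 3) ∞ Γ D := fun p hp ↦ by
  have := hV p hp
  rw [contMDiffWithinAt_totalSpace] at this
  exact this.1

theorem ContactSubRiemannian.contDiffOn_inner {V W : (p : E) → TangentSpace (𝓡 3) (Γ p)}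
    (hV : ContMDiffOn 𝓘(ℝ, E) ((𝓡 3).prod 𝓘(ℝ, E3)) ∞ (fun p ↦ TotalSpace.mk' E3 (Γ p) (V p)) D)
    (hW : ContMDiffOn 𝓘(ℝ, E) ((𝓡 3).prod 𝓘(ℝ, E3)) ∞ (fun p ↦ TotalSpace.mk' E3 (Γ p) (W p)) D) :
    ContDiffOn ℝ ∞ (fun p ↦ S.g.inner (Γ p) (V p) (W p)) D := by
  rw [← contMDiffOn_iff_contDiffOn]
  have : ContMDiffOn 𝓘(ℝ, E) ((𝓡 3).prod 𝓘(ℝ)) ∞ (fun p ↦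
      TotalSpace.mk' ℝ (E := Bundle.Trivial M ℝ) (Γ p) (S.g.inner (Γ p) (V p) (W p))) D := by
    refine ContMDiffOn.clm_bundle_apply₂ (F₁ := E3) (F₂ := E3) (F₃ := ℝ)
      (E₃ := fun x ↦ Bundle.Trivial M ℝ x) (ψ := fun p ↦ S.g.inner (Γ p)) (v := V) (w := W)
      (b := Γ) ?_ hV hW
    exact S.g.contMDiff.comp_contMDiffOn hV.of_lift
  intro p hp
  have := this p hp
  rw [contMDiffWithinAt_totalSpace] at this
  exact this.2

theorem ContactSubRiemannian.contMDiffOn_J {V : (p : E) → TangentSpace (𝓡 3) (Γ p)}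
    (hV : ContMDiffOn 𝓘(ℝ, E) ((𝓡 3).prod 𝓘(ℝ, E3)) ∞
      (fun p ↦ TotalSpace.mk' E3 (Γ p) (V p)) D) :
    ContMDiffOn 𝓘(ℝ, E) ((𝓡 3).prod 𝓘(ℝ, E3)) ∞
      (fun p ↦ TotalSpace.mk' E3 (Γ p) (S.J (Γ p) (V p))) D := by
  refine ContMDiffOn.clm_bundle_apply (F₁ := E3) (F₂ := E3)
      (E₂ := fun x : M ↦ TangentSpace (𝓡 3) x) (ϕ := fun p ↦ S.J (Γ p)) (v := V) (b := Γ) ?_ hV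
  exact S.smooth_J.comp_contMDiffOn hV.of_lift

theorem ContactSubRiemannian.contDiffOn_θ {V : (p : E) → TangentSpace (𝓡 3) (Γ p)}
    (hV : ContMDiffOn 𝓘(ℝ, E) ((𝓡 3).prod 𝓘(ℝ, E3)) ∞
      (fun p ↦ TotalSpace.mk' E3 (Γ p) (V p)) D) :
    ContDiffOn ℝ ∞ (fun p ↦ S.θ (Γ p) (V p)) D := by
  simp only [← S.inner_T]
  exact S.contDiffOn_inner hV (S.smooth_T.comp_contMDiffOn hV.of_lift)

theorem ContMDiffOn.smul_lift {f : E → ℝ} {V : (p : E) → TangentSpace (𝓡 3) (Γ p)}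
    (hf : ContDiffOn ℝ ∞ f D)
    (hV : ContMDiffOn 𝓘(ℝ, E) ((𝓡 3).prod 𝓘(ℝ, E3)) ∞
      (fun p ↦ TotalSpace.mk' E3 (Γ p) (V p)) D) :
    ContMDiffOn 𝓘(ℝ, E) ((𝓡 3).prod 𝓘(ℝ, E3)) ∞
      (fun p ↦ TotalSpace.mk' E3 (Γ p) (f p • V p)) D := by
  intro p hp
  have h := hV p hp
  rw [contMDiffWithinAt_totalSpace] at h ⊢
  let triv := trivializationAt E3 (fun x : M ↦ TangentSpace (𝓡 3) x) (Γ p)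
  have hx : Γ p ∈ triv.baseSet := FiberBundle.mem_baseSet_trivializationAt' (Γ p)
  refine ⟨h.1, ((hf.contMDiffOn p hp).smul h.2).congr_of_eventuallyEq_of_mem ?_ hp⟩
  filter_upwards [h.1.continuousWithinAt.preimage_mem_nhdsWithin
    (triv.open_baseSet.mem_nhds hx)] with q hq
  exact (triv.linear ℝ hq).map_smul (f q) (V q)

/-- The derivative of `Γ` in the direction `e`, as a field along `Γ`. -/
noncomputable def partialVelocity (Γ : E → M) (D : Set E) (e : E) (p : E) :
    TangentSpace (𝓡 3) (Γ p) :=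
  mfderivWithin 𝓘(ℝ, E) (𝓡 3) Γ D p e

theorem contMDiffOn_partialVelocity (hD : UniqueDiffOn ℝ D) (e : E)
    (hΓ : ContMDiffOn 𝓘(ℝ, E) (𝓡 3) ∞ Γ D) :
    ContMDiffOn 𝓘(ℝ, E) ((𝓡 3).prod 𝓘(ℝ, E3)) ∞
      (fun p ↦ TotalSpace.mk' E3 (Γ p) (partialVelocity Γ D e p)) D := by
  have h1 := hΓ.contMDiffOn_tangentMapWithin (m := ∞) (by simp) hD.uniqueMDiffOn
  have h2 : ContMDiffOn 𝓘(ℝ, E) (𝓘(ℝ, E).prod 𝓘(ℝ, E)) ∞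
      (fun p : E ↦ (TotalSpace.mk' E p e : TangentBundle 𝓘(ℝ, E) E)) D := by
    intro p hp
    exact contMDiffWithinAt_vectorSpace_iff_contDiffWithinAt.2 contDiffWithinAt_const
  exact h1.comp h2 fun p hp ↦ hp

/-- The trivialization of the tangent bundle is the differential of the chart, so this is the chain
rule. -/
theorem trivializationAt_partialVelocity {p₀ p : E} (hD : UniqueDiffOn ℝ D)
    (hΓ : ContMDiffOn 𝓘(ℝ, E) (𝓡 3) ∞ Γ D) (hp : p ∈ D)
    (hp' : Γ p ∈ (chartAt E3 (Γ p₀)).source) (e : E) :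
    (trivializationAt E3 (fun x : M ↦ TangentSpace (𝓡 3) x) (Γ p₀)
      (TotalSpace.mk' E3 (Γ p) (partialVelocity Γ D e p))).2 =
    fderivWithin ℝ (extChartAt (𝓡 3) (Γ p₀) ∘ Γ) D p e := by
  have h1 := (mdifferentiableAt_extChartAt (I := 𝓡 3) hp').hasMFDerivAt.comp_hasMFDerivWithinAt p
    (hΓ.mdifferentiableOn (by simp) p hp).hasMFDerivWithinAt
  have h2 : fderivWithin ℝ (extChartAt (𝓡 3) (Γ p₀) ∘ Γ) D p = _ :=
    HasFDerivWithinAt.fderivWithin (E := E) (F := E3) h1.hasFDerivWithinAt (hD p hp)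
  rw [h2]
  have h3 := TangentBundle.continuousLinearMapAt_trivializationAt (𝕜 := ℝ) (I := 𝓡 3) hp'
  have h4 := Trivialization.continuousLinearMapAt_apply_of_mem (R := ℝ)
    (trivializationAt E3 (fun x : M ↦ TangentSpace (𝓡 3) x) (Γ p₀)) hp' (partialVelocity Γ D e p)
  refine h4.symm.trans ?_
  exact congrArg (fun L : TangentSpace (𝓡 3) (Γ p) →L[ℝ] E3 ↦ L (partialVelocity Γ D e p)) h3

end Lifts

/-! ### Torsion and mixed second derivatives -/

section Torsion

variable {M : Type*} [TopologicalSpace M] [ChartedSpace E3 M] [IsManifold (𝓡 3) ∞ M]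

theorem eventually_mpullbackWithin_extend (x : M) (e : TangentSpace (𝓡 3) x) :
    ∀ᶠ z in nhdsWithin (extChartAt (𝓡 3) x x) (range (𝓡 3)),
      (VectorField.mpullbackWithin 𝓘(ℝ, E3) (𝓡 3) (extChartAt (𝓡 3) x).symm
        (FiberBundle.extend E3 e : VField M) (range (𝓡 3)) z : E3) =
      (trivializationAt E3 (fun x : M ↦ TangentSpace (𝓡 3) x) x (TotalSpace.mk' E3 x e)).2 := by
  filter_upwards [extChartAt_target_mem_nhdsWithin x] with z hz
  have hy : (extChartAt (𝓡 3) x).symm z ∈ (chartAt E3 x).source := by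
    rw [← extChartAt_source (𝓡 3)]
    exact (extChartAt (𝓡 3) x).map_target hz
  have h1 := TangentBundle.symmL_trivializationAt (𝕜 := ℝ) (I := 𝓡 3) hy
  rw [(extChartAt (𝓡 3) x).right_inv hz] at h1
  rw [VectorField.mpullbackWithin_apply, extend_eq_constField _ hy]
  have h2 := isInvertible_mfderivWithin_extChartAt_symm (I := 𝓡 3) hz
  refine h2.inverse_apply_eq.2 ?_
  exact congrArg (fun L : E3 →L[ℝ] TangentSpace (𝓡 3) ((extChartAt (𝓡 3) x).symm z) ↦ L
    (trivializationAt E3 (fun x : M ↦ TangentSpace (𝓡 3) x) x (TotalSpace.mk' E3 x e)).2) h1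

/-- In the chart at x both fields are constant near x, and constant fields commute. -/
theorem mlieBracket_extend (x : M) (u v : TangentSpace (𝓡 3) x) :
    VectorField.mlieBracket (𝓡 3) (FiberBundle.extend E3 u) (FiberBundle.extend E3 v) x = 0 := by
  have hz (e : TangentSpace (𝓡 3) x) : fderivWithin ℝ (VectorField.mpullbackWithin 𝓘(ℝ, E3) (𝓡 3)
      (extChartAt (𝓡 3) x).symm (FiberBundle.extend E3 e : VField M) (range (𝓡 3)) : E3 → E3)
      (range (𝓡 3)) (extChartAt (𝓡 3) x x) = 0 := by
    rw [Filter.EventuallyEq.fderivWithin_eq_of_mem (eventually_mpullbackWithin_extend x e)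
      (by simp)]
    exact fderivWithin_const_apply ..
  have key : VectorField.lieBracketWithin ℝ
      (VectorField.mpullbackWithin 𝓘(ℝ, E3) (𝓡 3)
        (extChartAt (𝓡 3) x).symm (FiberBundle.extend E3 u : VField M) (range (𝓡 3)) : E3 → E3)
      (VectorField.mpullbackWithin 𝓘(ℝ, E3) (𝓡 3)
        (extChartAt (𝓡 3) x).symm (FiberBundle.extend E3 v : VField M) (range (𝓡 3)) : E3 → E3)
      (range (𝓡 3)) (extChartAt (𝓡 3) x x) = 0 := by
    simp only [VectorField.lieBracketWithin, hz u, hz v]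
    exact sub_self (0 : E3)
  rw [VectorField.mlieBracket, VectorField.mlieBracketWithin_apply, preimage_univ, univ_inter]
  exact (congrArg _ key).trans (map_zero _)

theorem torsion_eq_nabla_extend
    (nabla : CovariantDerivative (𝓡 3) E3 (fun x : M ↦ TangentSpace (𝓡 3) x)) (x : M)
    (u v : TangentSpace (𝓡 3) x) : nabla.torsion x u v =
      nabla (FiberBundle.extend E3 v) x u - nabla (FiberBundle.extend E3 u) x v := by
  rw [nabla.torsion_apply_eq_extend, mlieBracket_extend]
  simp only [FiberBundle.extend_apply_self, sub_zero]

variable {Γ : ℝ × ℝ → M} {s₁ s₂ : Set ℝ}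

omit [IsManifold (𝓡 3) ∞ M] in
theorem velocity_fst (h₁ : UniqueDiffOn ℝ s₁) (hΓ : ContMDiffOn 𝓘(ℝ, ℝ × ℝ) (𝓡 3) ∞ Γ (s₁ ×ˢ s₂))
    {u t : ℝ} (hu : u ∈ s₁) (ht : t ∈ s₂) :
    velocity (fun w ↦ Γ (w, t)) s₁ u = partialVelocity Γ (s₁ ×ˢ s₂) (1, 0) (u, t) := by
  have h : HasDerivWithinAt (fun w : ℝ ↦ (w, t)) (1, 0) s₁ u :=
    (hasDerivWithinAt_id u s₁).prodMk (hasDerivWithinAt_const u s₁ t)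
  have hm : MapsTo (fun w : ℝ ↦ (w, t)) s₁ (s₁ ×ˢ s₂) := fun w hw ↦ ⟨hw, ht⟩
  have h' := (hΓ.mdifferentiableOn (by simp) (u, t) ⟨hu, ht⟩).hasMFDerivWithinAt.comp u
    h.hasFDerivWithinAt.hasMFDerivWithinAt hm
  have h'' := h'.mfderivWithin (h₁.uniqueMDiffOn u hu)
  have := congrArg (fun L : ℝ →L[ℝ] TangentSpace (𝓡 3) (Γ (u, t)) ↦ L 1) h''
  refine this.trans ?_
  exact congrArg (fun q ↦ partialVelocity Γ (s₁ ×ˢ s₂) q (u, t)) (one_smul ℝ ((1, 0) : ℝ × ℝ))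

omit [IsManifold (𝓡 3) ∞ M] in
theorem velocity_snd (h₂ : UniqueDiffOn ℝ s₂) (hΓ : ContMDiffOn 𝓘(ℝ, ℝ × ℝ) (𝓡 3) ∞ Γ (s₁ ×ˢ s₂))
    {u t : ℝ} (hu : u ∈ s₁) (ht : t ∈ s₂) :
    velocity (fun r ↦ Γ (u, r)) s₂ t = partialVelocity Γ (s₁ ×ˢ s₂) (0, 1) (u, t) := by
  have h : HasDerivWithinAt (fun r : ℝ ↦ (u, r)) (0, 1) s₂ t :=
    (hasDerivWithinAt_const t s₂ u).prodMk (hasDerivWithinAt_id t s₂)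
  have hm : MapsTo (fun r : ℝ ↦ (u, r)) s₂ (s₁ ×ˢ s₂) := fun r hr ↦ ⟨hu, hr⟩
  have h' := (hΓ.mdifferentiableOn (by simp) (u, t) ⟨hu, ht⟩).hasMFDerivWithinAt.comp t
    h.hasFDerivWithinAt.hasMFDerivWithinAt hm
  have h'' := h'.mfderivWithin (h₂.uniqueMDiffOn t ht)
  have := congrArg (fun L : ℝ →L[ℝ] TangentSpace (𝓡 3) (Γ (u, t)) ↦ L 1) h''
  refine this.trans ?_
  exact congrArg (fun q ↦ partialVelocity Γ (s₁ ×ˢ s₂) q (u, t)) (one_smul ℝ ((0, 1) : ℝ × ℝ))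

/-- The two mixed second derivatives of a map into `M` differ by the torsion. -/
theorem covAlong_sub_covAlong
    (nabla : CovariantDerivative (𝓡 3) E3 (fun x : M ↦ TangentSpace (𝓡 3) x))
    (h₁ : UniqueDiffOn ℝ s₁) (h₂ : UniqueDiffOn ℝ s₂) (h₁' : s₁ ⊆ closure (interior s₁))
    (h₂' : s₂ ⊆ closure (interior s₂)) (hΓ : ContMDiffOn 𝓘(ℝ, ℝ × ℝ) (𝓡 3) ∞ Γ (s₁ ×ˢ s₂))
    {u t : ℝ} (hu : u ∈ s₁) (ht : t ∈ s₂) :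
    covAlong nabla (fun r ↦ Γ (u, r)) s₂
        (fun r ↦ partialVelocity Γ (s₁ ×ˢ s₂) (1, 0) (u, r)) t -
      covAlong nabla (fun w ↦ Γ (w, t)) s₁
        (fun w ↦ partialVelocity Γ (s₁ ×ˢ s₂) (0, 1) (w, t)) u =
      nabla.torsion (Γ (u, t)) (partialVelocity Γ (s₁ ×ˢ s₂) (0, 1) (u, t))
        (partialVelocity Γ (s₁ ×ˢ s₂) (1, 0) (u, t)) := by
  set D := s₁ ×ˢ s₂ with hD
  have hDu : UniqueDiffOn ℝ D := h₁.prod h₂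
  have hp : (u, t) ∈ D := ⟨hu, ht⟩
  let φ : ℝ × ℝ → E3 := extChartAt (𝓡 3) (Γ (u, t)) ∘ Γ
  have hφ : ContDiffWithinAt ℝ ∞ φ D (u, t) := by
    rw [← contMDiffWithinAt_iff_contDiffWithinAt]
    exact ContMDiffAt.comp_contMDiffWithinAt (u, t) contMDiffAt_extChartAt (hΓ _ hp)
  -- The point may lie on the boundary of D; symmetry persists there because D lies in the closure
  -- of its interior.
  have hsymm : IsSymmSndFDerivWithinAt ℝ φ D (u, t) := by
    refine hφ.isSymmSndFDerivWithinAt (by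
      rw [minSmoothness_of_isRCLikeNormedField]
      exact WithTop.coe_le_coe.2 le_top) hDu ?_ hp
    rw [hD, interior_prod_eq, closure_prod_eq]
    exact ⟨h₁' hu, h₂' ht⟩
  have hφ' : HasFDerivWithinAt (fderivWithin ℝ φ D) (fderivWithin ℝ (fderivWithin ℝ φ D) D (u, t))
      D (u, t) :=
    ((hφ.fderivWithin_right (m := 1) hDu (by norm_cast) hp).differentiableWithinAt
      (by simp)).hasFDerivWithinAt
  have hev : ∀ᶠ p in nhdsWithin (u, t) D, Γ p ∈ (chartAt E3 (Γ (u, t))).source :=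
    (hΓ _ hp).continuousWithinAt.preimage_mem_nhdsWithin (chart_source_mem_nhds _ _)
  have hs : HasDerivWithinAt (fun r : ℝ ↦ (u, r)) (0, 1) s₂ t :=
    (hasDerivWithinAt_const t s₂ u).prodMk (hasDerivWithinAt_id t s₂)
  have hf : HasDerivWithinAt (fun w : ℝ ↦ (w, t)) (1, 0) s₁ u :=
    (hasDerivWithinAt_id u s₁).prodMk (hasDerivWithinAt_const u s₁ t)
  have hms : MapsTo (fun r : ℝ ↦ (u, r)) s₂ D := fun r hr ↦ ⟨hu, hr⟩
  have hmf : MapsTo (fun w : ℝ ↦ (w, t)) s₁ D := fun w hw ↦ ⟨hw, ht⟩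
  have hs' : Filter.Tendsto (fun r : ℝ ↦ (u, r)) (nhdsWithin t s₂) (nhdsWithin (u, t) D) :=
    hs.continuousWithinAt.tendsto_nhdsWithin hms
  have hf' : Filter.Tendsto (fun w : ℝ ↦ (w, t)) (nhdsWithin u s₁) (nhdsWithin (u, t) D) :=
    hf.continuousWithinAt.tendsto_nhdsWithin hmf
  have d1 : derivWithin (fun r ↦ (trivializationAt E3 (fun x : M ↦ TangentSpace (𝓡 3) x) (Γ (u, t))
      (TotalSpace.mk' E3 (Γ (u, r)) (partialVelocity Γ D (1, 0) (u, r)))).2) s₂ t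
      = fderivWithin ℝ (fderivWithin ℝ φ D) D (u, t) (0, 1) (1, 0) := by
    have := (hφ'.comp_hasDerivWithinAt t (f := fun r : ℝ ↦ (u, r)) hs hms).clm_apply
      (hasDerivWithinAt_const t s₂ ((1, 0) : ℝ × ℝ))
    simp only [map_zero, add_zero] at this
    refine (this.congr_of_eventuallyEq_of_mem ?_ ht).derivWithin (h₂ t ht)
    filter_upwards [hs'.eventually hev, self_mem_nhdsWithin] with r hr hr'
    exact trivializationAt_partialVelocity hDu hΓ ⟨hu, hr'⟩ hr _
  have d2 : derivWithin (fun w ↦ (trivializationAt E3 (fun x : M ↦ TangentSpace (𝓡 3) x) (Γ (u, t))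
      (TotalSpace.mk' E3 (Γ (w, t)) (partialVelocity Γ D (0, 1) (w, t)))).2) s₁ u
      = fderivWithin ℝ (fderivWithin ℝ φ D) D (u, t) (1, 0) (0, 1) := by
    have := (hφ'.comp_hasDerivWithinAt u (f := fun w : ℝ ↦ (w, t)) hf hmf).clm_apply
      (hasDerivWithinAt_const u s₁ ((0, 1) : ℝ × ℝ))
    simp only [map_zero, add_zero] at this
    refine (this.congr_of_eventuallyEq_of_mem ?_ hu).derivWithin (h₁ u hu)
    filter_upwards [hf'.eventually hev, self_mem_nhdsWithin] with w hw hw'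
    exact trivializationAt_partialVelocity hDu hΓ ⟨hw', ht⟩ hw _
  -- By symmetry the coordinate terms cancel, and the two connection terms differ by the torsion.
  rw [torsion_eq_nabla_extend, covAlong_eq, covAlong_eq, d1, d2, hsymm.eq, velocity_fst h₁ hΓ hu ht,
    velocity_snd h₂ hΓ hu ht]
  exact add_sub_add_left_eq_sub _ _ _

end Torsion

/-! ### Scalar linear equations and primitives on an interval -/

/-- On [0, t] the coefficient is bounded by compactness, so |f'| ≤ K|f| and Grönwall applies. The
coefficient q may itself involve f. -/
theorem eq_zero_of_hasDerivWithinAt_mul {f q : ℝ → ℝ} {T : ℝ}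
    (hf : ∀ t ∈ Ico 0 T, HasDerivWithinAt f (q t * f t) (Ico 0 T) t)
    (hq : ContinuousOn q (Ico 0 T)) (h0 : f 0 = 0) : ∀ t ∈ Ico 0 T, f t = 0 := by
  intro t ht
  have hsub : Icc 0 t ⊆ Ico 0 T := Icc_subset_Ico_right ht.2
  obtain ⟨K, hK⟩ := isCompact_Icc.exists_bound_of_continuousOn (hq.mono hsub)
  refine eq_zero_of_abs_deriv_le_mul_abs_self_of_eq_zero_right (a := 0) (b := t) (K := K)
    (f' := fun r ↦ q r * f r) (fun r hr ↦ ((hf r (hsub hr)).continuousWithinAt).mono hsub)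
    (fun r hr ↦ ?_) h0 (fun r hr ↦ ?_) t (right_mem_Icc.2 ht.1)
  · have hr' := hsub (Ico_subset_Icc_self hr)
    refine (hf r hr').mono_of_mem_nhdsWithin ?_
    exact Filter.mem_of_superset (Ico_mem_nhdsGE hr'.2) (Ico_subset_Ico_left hr'.1)
  · rw [norm_mul]
    exact mul_le_mul_of_nonneg_right (hK r (Ico_subset_Icc_self hr)) (norm_nonneg _)

theorem eq_exp_mul_of_hasDerivWithinAt {f : ℝ → ℝ} {c T : ℝ}
    (hf : ∀ t ∈ Ico 0 T, HasDerivWithinAt f (c * f t) (Ico 0 T) t) :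
    ∀ t ∈ Ico 0 T, f t = Real.exp (c * t) * f 0 := by
  intro t ht
  refine sub_eq_zero.1 (eq_zero_of_hasDerivWithinAt_mul (q := fun _ ↦ c)
    (f := fun r ↦ f r - Real.exp (c * r) * f 0) (fun r hr ↦ ?_) continuousOn_const (by simp) t ht)
  have h1 := (((hasDerivAt_id r).const_mul c).exp.mul_const (f 0)).hasDerivWithinAt (s := Ico 0 T)
  refine ((hf r hr).sub h1).congr_deriv ?_
  simp only [id]
  ring

theorem hasDerivWithinAt_integral_Icc {f : ℝ → ℝ} {a b c u : ℝ} (hf : ContinuousOn f (Icc a b))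
    (hc : c ∈ Icc a b) (hu : u ∈ Icc a b) :
    HasDerivWithinAt (fun w ↦ ∫ x in c..w, f x) (f u) (Icc a b) u := by
  have : Fact (u ∈ Icc a b) := ⟨hu⟩
  refine intervalIntegral.integral_hasDerivWithinAt_right
    ((hf.mono (uIcc_subset_Icc hc hu)).intervalIntegrable)
    (hf.stronglyMeasurableAtFilter_nhdsWithin measurableSet_Icc u) (hf u hu)

/-! ### Evolution of `θ(X)`, the speed and the length -/

section Flow

variable {M : Type*} [TopologicalSpace M] [ChartedSpace E3 M] [IsManifold (𝓡 3) ∞ M]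
  {S : ContactSubRiemannian M}
  {nabla : CovariantDerivative (𝓡 3) E3 (fun x : M ↦ TangentSpace (𝓡 3) x)}
  {Γ : ℝ × ℝ → M} {s₁ s₂ : Set ℝ}

theorem mdifferentiableWithinAt_lift_fst {V : (p : ℝ × ℝ) → TangentSpace (𝓡 3) (Γ p)}
    (hV : ContMDiffOn 𝓘(ℝ, ℝ × ℝ) ((𝓡 3).prod 𝓘(ℝ, E3)) ∞
      (fun p ↦ TotalSpace.mk' E3 (Γ p) (V p)) (s₁ ×ˢ s₂)) {u t : ℝ} (hu : u ∈ s₁) (ht : t ∈ s₂) :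
    MDifferentiableWithinAt 𝓘(ℝ) ((𝓡 3).prod 𝓘(ℝ, E3))
      (fun w ↦ TotalSpace.mk' E3 (Γ (w, t)) (V (w, t))) s₁ u := by
  have hm : MapsTo (fun w : ℝ ↦ (w, t)) s₁ (s₁ ×ˢ s₂) := fun w hw ↦ ⟨hw, ht⟩
  have h : ContMDiffOn 𝓘(ℝ) 𝓘(ℝ, ℝ × ℝ) ∞ (fun w : ℝ ↦ (w, t)) s₁ :=
    (contDiff_id.prodMk contDiff_const).contDiffOn.contMDiffOn
  exact (hV.comp h hm).mdifferentiableOn (by simp) u hu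

theorem mdifferentiableWithinAt_lift_snd {V : (p : ℝ × ℝ) → TangentSpace (𝓡 3) (Γ p)}
    (hV : ContMDiffOn 𝓘(ℝ, ℝ × ℝ) ((𝓡 3).prod 𝓘(ℝ, E3)) ∞
      (fun p ↦ TotalSpace.mk' E3 (Γ p) (V p)) (s₁ ×ˢ s₂)) {u t : ℝ} (hu : u ∈ s₁) (ht : t ∈ s₂) :
    MDifferentiableWithinAt 𝓘(ℝ) ((𝓡 3).prod 𝓘(ℝ, E3))
      (fun r ↦ TotalSpace.mk' E3 (Γ (u, r)) (V (u, r))) s₂ t := by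
  have hm : MapsTo (fun r : ℝ ↦ (u, r)) s₂ (s₁ ×ˢ s₂) := fun r hr ↦ ⟨hu, hr⟩
  have h : ContMDiffOn 𝓘(ℝ) 𝓘(ℝ, ℝ × ℝ) ∞ (fun r : ℝ ↦ (u, r)) s₂ :=
    (contDiff_const.prodMk contDiff_id).contDiffOn.contMDiffOn
  exact (hV.comp h hm).mdifferentiableOn (by simp) t ht

variable {γ₀ : ℝ → M} {a b u₀ T₀ : ℝ}

/-- `∂Γ/∂u` on the rectangle `[a, b] × [0, T₀)`. -/
noncomputable def fstVelocity (Γ : ℝ × ℝ → M) (a b T₀ : ℝ) (p : ℝ × ℝ) : TangentSpace (𝓡 3) (Γ p) :=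
  partialVelocity Γ (Icc a b ×ˢ Ico 0 T₀) (1, 0) p

/-- `∂Γ/∂t` on the rectangle `[a, b] × [0, T₀)`. -/
noncomputable def sndVelocity (Γ : ℝ × ℝ → M) (a b T₀ : ℝ) (p : ℝ × ℝ) : TangentSpace (𝓡 3) (Γ p) :=
  partialVelocity Γ (Icc a b ×ˢ Ico 0 T₀) (0, 1) p

namespace IsExpandingFlow

theorem smooth' (hγ : IsExpandingFlow S nabla (fun u t ↦ Γ (u, t)) γ₀ a b u₀ T₀) :
    ContMDiffOn 𝓘(ℝ, ℝ × ℝ) (𝓡 3) ∞ Γ (Icc a b ×ˢ Ico 0 T₀) := hγ.smooth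

theorem contMDiffOn_fstVelocity (hab : a < b)
    (hγ : IsExpandingFlow S nabla (fun u t ↦ Γ (u, t)) γ₀ a b u₀ T₀) :
    ContMDiffOn 𝓘(ℝ, ℝ × ℝ) ((𝓡 3).prod 𝓘(ℝ, E3)) ∞
      (fun p ↦ TotalSpace.mk' E3 (Γ p) (fstVelocity Γ a b T₀ p)) (Icc a b ×ˢ Ico 0 T₀) :=
  contMDiffOn_partialVelocity ((uniqueDiffOn_Icc hab).prod (uniqueDiffOn_Ico 0 T₀)) _ hγ.smooth'

theorem contMDiffOn_sndVelocity (hab : a < b)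
    (hγ : IsExpandingFlow S nabla (fun u t ↦ Γ (u, t)) γ₀ a b u₀ T₀) :
    ContMDiffOn 𝓘(ℝ, ℝ × ℝ) ((𝓡 3).prod 𝓘(ℝ, E3)) ∞
      (fun p ↦ TotalSpace.mk' E3 (Γ p) (sndVelocity Γ a b T₀ p)) (Icc a b ×ˢ Ico 0 T₀) :=
  contMDiffOn_partialVelocity ((uniqueDiffOn_Icc hab).prod (uniqueDiffOn_Ico 0 T₀)) _ hγ.smooth'

variable {u t : ℝ}

theorem velocity_eq (hab : a < b)
    (hγ : IsExpandingFlow S nabla (fun u t ↦ Γ (u, t)) γ₀ a b u₀ T₀)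
    (hu : u ∈ Icc a b) (ht : t ∈ Ico 0 T₀) :
    velocity (fun w ↦ Γ (w, t)) (Icc a b) u = fstVelocity Γ a b T₀ (u, t) :=
  velocity_fst (uniqueDiffOn_Icc hab) hγ.smooth' hu ht

theorem inner_fstVelocity_pos (hab : a < b)
    (hγ : IsExpandingFlow S nabla (fun u t ↦ Γ (u, t)) γ₀ a b u₀ T₀)
    (hu : u ∈ Icc a b) (ht : t ∈ Ico 0 T₀) :
    0 < S.g.inner (Γ (u, t)) (fstVelocity Γ a b T₀ (u, t)) (fstVelocity Γ a b T₀ (u, t)) := by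
  rw [← hγ.velocity_eq hab hu ht]
  exact S.inner_self_pos (hγ.immersed t ht u hu)

theorem speed_eq (hab : a < b)
    (hγ : IsExpandingFlow S nabla (fun u t ↦ Γ (u, t)) γ₀ a b u₀ T₀)
    (hu : u ∈ Icc a b) (ht : t ∈ Ico 0 T₀) :
    speed S (fun w ↦ Γ (w, t)) (Icc a b) u = √(S.g.inner (Γ (u, t)) (fstVelocity Γ a b T₀ (u, t))
      (fstVelocity Γ a b T₀ (u, t))) := by
  rw [speed, hγ.velocity_eq hab hu ht]

theorem inner_fstVelocity_self (hab : a < b)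
    (hγ : IsExpandingFlow S nabla (fun u t ↦ Γ (u, t)) γ₀ a b u₀ T₀)
    (hu : u ∈ Icc a b) (ht : t ∈ Ico 0 T₀) :
    S.g.inner (Γ (u, t)) (fstVelocity Γ a b T₀ (u, t)) (fstVelocity Γ a b T₀ (u, t)) =
      speed S (fun w ↦ Γ (w, t)) (Icc a b) u ^ 2 := by
  rw [hγ.speed_eq hab hu ht, Real.sq_sqrt (hγ.inner_fstVelocity_pos hab hu ht).le]

theorem speed_pos (hab : a < b)
    (hγ : IsExpandingFlow S nabla (fun u t ↦ Γ (u, t)) γ₀ a b u₀ T₀)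
    (hu : u ∈ Icc a b) (ht : t ∈ Ico 0 T₀) : 0 < speed S (fun w ↦ Γ (w, t)) (Icc a b) u := by
  rw [hγ.speed_eq hab hu ht]
  exact Real.sqrt_pos.2 (hγ.inner_fstVelocity_pos hab hu ht)

theorem contDiffOn_speed (hab : a < b)
    (hγ : IsExpandingFlow S nabla (fun u t ↦ Γ (u, t)) γ₀ a b u₀ T₀) :
    ContDiffOn ℝ ∞ (fun p : ℝ × ℝ ↦ speed S (fun w ↦ Γ (w, p.2)) (Icc a b) p.1)
      (Icc a b ×ˢ Ico 0 T₀) := by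
  have h := hγ.contMDiffOn_fstVelocity hab
  refine ((S.contDiffOn_inner h h).sqrt fun p hp ↦
    (hγ.inner_fstVelocity_pos hab hp.1 hp.2).ne').congr fun p hp ↦ hγ.speed_eq hab hp.1 hp.2

theorem unitTangent_eq (hab : a < b)
    (hγ : IsExpandingFlow S nabla (fun u t ↦ Γ (u, t)) γ₀ a b u₀ T₀)
    (hu : u ∈ Icc a b) (ht : t ∈ Ico 0 T₀) :
    unitTangent S (fun w ↦ Γ (w, t)) (Icc a b) u =
      (speed S (fun w ↦ Γ (w, t)) (Icc a b) u)⁻¹ • fstVelocity Γ a b T₀ (u, t) := by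
  rw [unitTangent, hγ.velocity_eq hab hu ht]

theorem sndVelocity_eq
    (hγ : IsExpandingFlow S nabla (fun u t ↦ Γ (u, t)) γ₀ a b u₀ T₀)
    (hu : u ∈ Icc a b) (ht : t ∈ Ico 0 T₀) :
    sndVelocity Γ a b T₀ (u, t) =
      -(curvature S nabla (fun w ↦ Γ (w, t)) (Icc a b) u)⁻¹ •
          S.J (Γ (u, t)) (unitTangent S (fun w ↦ Γ (w, t)) (Icc a b) u)
        - (2 * ∫ w in u₀..u, (curvature S nabla (fun w ↦ Γ (w, t)) (Icc a b) w)⁻¹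
            * speed S (fun w ↦ Γ (w, t)) (Icc a b) w) • S.T (Γ (u, t)) :=
  (velocity_snd (uniqueDiffOn_Ico 0 T₀) hγ.smooth' hu ht).symm.trans (hγ.equation t ht u hu)

/-- Horizontality of X is not yet known, but JX = 0 would force k = 0. -/
theorem inner_J_fstVelocity_ne_zero (hab : a < b)
    (hγ : IsExpandingFlow S nabla (fun u t ↦ Γ (u, t)) γ₀ a b u₀ T₀)
    (hu : u ∈ Icc a b) (ht : t ∈ Ico 0 T₀) :
    S.g.inner (Γ (u, t)) (S.J _ (fstVelocity Γ a b T₀ (u, t)))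
      (S.J _ (fstVelocity Γ a b T₀ (u, t))) ≠ 0 := by
  refine (S.inner_self_pos fun h ↦ hγ.curvature_ne_zero t ht u hu ?_).ne'
  rw [curvature, hγ.unitTangent_eq hab hu ht, (S.J (Γ (u, t))).map_smul, h, smul_zero, map_zero]

/-- Pairing the flow equation with JX, which is orthogonal to T, isolates k⁻¹. It is thus expressed
by first derivatives of Γ, which makes its joint continuity immediate. -/
theorem curvature_inv_eq (hab : a < b)
    (hγ : IsExpandingFlow S nabla (fun u t ↦ Γ (u, t)) γ₀ a b u₀ T₀)
    (hu : u ∈ Icc a b) (ht : t ∈ Ico 0 T₀) :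
    (curvature S nabla (fun w ↦ Γ (w, t)) (Icc a b) u)⁻¹ =
      -(speed S (fun w ↦ Γ (w, t)) (Icc a b) u * S.g.inner (Γ (u, t)) (sndVelocity Γ a b T₀ (u, t))
        (S.J _ (fstVelocity Γ a b T₀ (u, t)))) /
      S.g.inner (Γ (u, t)) (S.J _ (fstVelocity Γ a b T₀ (u, t)))
        (S.J _ (fstVelocity Γ a b T₀ (u, t))) := by
  have h1 := hγ.inner_J_fstVelocity_ne_zero hab hu ht
  have h2 := (hγ.speed_pos hab hu ht).ne'
  rw [hγ.sndVelocity_eq hu ht, hγ.unitTangent_eq hab hu ht, eq_div_iff h1]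
  simp only [map_sub, map_smul, sub_apply, smul_apply, smul_eq_mul, S.inner_T_left, S.θ_J_apply]
  field_simp
  ring

theorem continuousOn_curvature_inv (hab : a < b)
    (hγ : IsExpandingFlow S nabla (fun u t ↦ Γ (u, t)) γ₀ a b u₀ T₀) :
    ContinuousOn (fun p : ℝ × ℝ ↦ (curvature S nabla (fun w ↦ Γ (w, p.2)) (Icc a b) p.1)⁻¹)
      (Icc a b ×ˢ Ico 0 T₀) := by
  have hX := hγ.contMDiffOn_fstVelocity hab
  have hY := hγ.contMDiffOn_sndVelocity hab
  have hJ := S.contMDiffOn_J hX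
  refine ContinuousOn.congr (ContinuousOn.div ((hγ.contDiffOn_speed hab).continuousOn.mul
    (S.contDiffOn_inner hY hJ).continuousOn).neg (S.contDiffOn_inner hJ hJ).continuousOn
    fun p hp ↦ hγ.inner_J_fstVelocity_ne_zero hab hp.1 hp.2) fun p hp ↦
      hγ.curvature_inv_eq hab hp.1 hp.2

theorem torsion_eq (hnabla : IsTanakaConnection S nabla) (hS : IsSasakian S nabla) (hab : a < b)
    (hγ : IsExpandingFlow S nabla (fun u t ↦ Γ (u, t)) γ₀ a b u₀ T₀)
    (hu : u ∈ Icc a b) (ht : t ∈ Ico 0 T₀) :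
    nabla.torsion (Γ (u, t)) (sndVelocity Γ a b T₀ (u, t)) (fstVelocity Γ a b T₀ (u, t)) =
      (2 * (curvature S nabla (fun w ↦ Γ (w, t)) (Icc a b) u)⁻¹ *
        (speed S (fun w ↦ Γ (w, t)) (Icc a b) u)⁻¹ *
        S.g.inner (Γ (u, t)) (S.J _ (fstVelocity Γ a b T₀ (u, t)))
          (S.J _ (fstVelocity Γ a b T₀ (u, t)))) • S.T (Γ (u, t)) := by
  rw [hγ.sndVelocity_eq hu ht, hγ.unitTangent_eq hab hu ht]
  simp only [map_sub, map_smul, sub_apply, smul_apply, hS.torsion_T, torsion_J_left hnabla hS,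
    smul_zero, sub_zero, smul_smul]
  congr 1
  ring

theorem covAlong_fstVelocity (hnabla : IsTanakaConnection S nabla) (hS : IsSasakian S nabla)
    (hab : a < b)
    (hγ : IsExpandingFlow S nabla (fun u t ↦ Γ (u, t)) γ₀ a b u₀ T₀)
    (hu : u ∈ Icc a b) (ht : t ∈ Ico 0 T₀) :
    covAlong nabla (fun r ↦ Γ (u, r)) (Ico 0 T₀) (fun r ↦ fstVelocity Γ a b T₀ (u, r)) t =
      covAlong nabla (fun w ↦ Γ (w, t)) (Icc a b) (fun w ↦ sndVelocity Γ a b T₀ (w, t)) u +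
      (2 * (curvature S nabla (fun w ↦ Γ (w, t)) (Icc a b) u)⁻¹ *
        (speed S (fun w ↦ Γ (w, t)) (Icc a b) u)⁻¹ *
        S.g.inner (Γ (u, t)) (S.J _ (fstVelocity Γ a b T₀ (u, t)))
          (S.J _ (fstVelocity Γ a b T₀ (u, t)))) • S.T (Γ (u, t)) := by
  rw [← hγ.torsion_eq hnabla hS hab hu ht, ← sub_eq_iff_eq_add']
  refine covAlong_sub_covAlong nabla (uniqueDiffOn_Icc hab) (uniqueDiffOn_Ico 0 T₀) ?_ ?_ hγ.smooth'
    hu ht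
  · rw [closure_interior_Icc hab.ne]
  · rw [interior_Ico, closure_Ioo (ht.1.trans_lt ht.2).ne]
    exact Ico_subset_Icc_self

theorem θ_sndVelocity
    (hγ : IsExpandingFlow S nabla (fun u t ↦ Γ (u, t)) γ₀ a b u₀ T₀)
    (hu : u ∈ Icc a b) (ht : t ∈ Ico 0 T₀) :
    S.θ (Γ (u, t)) (sndVelocity Γ a b T₀ (u, t)) =
      -2 * ∫ w in u₀..u, (curvature S nabla (fun w ↦ Γ (w, t)) (Icc a b) w)⁻¹
            * speed S (fun w ↦ Γ (w, t)) (Icc a b) w := by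
  rw [hγ.sndVelocity_eq hu ht, map_sub, map_smul, map_smul, S.θ_J_apply, S.θ_T]
  simp

theorem θ_covAlong_sndVelocity (hnabla : IsTanakaConnection S nabla) (hab : a < b)
    (hu₀ : u₀ ∈ Icc a b) (hγ : IsExpandingFlow S nabla (fun u t ↦ Γ (u, t)) γ₀ a b u₀ T₀)
    (hu : u ∈ Icc a b) (ht : t ∈ Ico 0 T₀) :
    S.θ (Γ (u, t)) (covAlong nabla (fun w ↦ Γ (w, t)) (Icc a b)
      (fun w ↦ sndVelocity Γ a b T₀ (w, t)) u) =
      -2 * ((curvature S nabla (fun w ↦ Γ (w, t)) (Icc a b) u)⁻¹ *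
        speed S (fun w ↦ Γ (w, t)) (Icc a b) u) := by
  have hm : MapsTo (fun w : ℝ ↦ (w, t)) (Icc a b) (Icc a b ×ˢ Ico 0 T₀) := fun w hw ↦ ⟨hw, ht⟩
  have hc : ContinuousOn (fun w ↦ (curvature S nabla (fun w ↦ Γ (w, t)) (Icc a b) w)⁻¹
      * speed S (fun w ↦ Γ (w, t)) (Icc a b) w) (Icc a b) :=
    ((hγ.continuousOn_curvature_inv hab).mul (hγ.contDiffOn_speed hab).continuousOn).comp
      (f := fun w : ℝ ↦ (w, t)) (by fun_prop) hm
  -- The u-derivative of θ(Y) is computed twice: by ∇θ = 0 and by the fundamental theorem of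
  -- calculus.
  exact (uniqueDiffOn_Icc hab u hu).eq_deriv _
    (hasDerivWithinAt_θ hnabla hu
      (mdifferentiableWithinAt_lift_fst (hγ.contMDiffOn_sndVelocity hab) hu ht))
    (((hasDerivWithinAt_integral_Icc hc hu₀ hu).const_mul (-2)).congr_of_mem
      (fun w hw ↦ hγ.θ_sndVelocity hw ht) hu)

theorem hasDerivWithinAt_θ_fstVelocity (hnabla : IsTanakaConnection S nabla)
    (hS : IsSasakian S nabla) (hab : a < b) (hu₀ : u₀ ∈ Icc a b)
    (hγ : IsExpandingFlow S nabla (fun u t ↦ Γ (u, t)) γ₀ a b u₀ T₀)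
    (hu : u ∈ Icc a b) (ht : t ∈ Ico 0 T₀) :
    HasDerivWithinAt (fun r ↦ S.θ (Γ (u, r)) (fstVelocity Γ a b T₀ (u, r)))
      (-2 * (curvature S nabla (fun w ↦ Γ (w, t)) (Icc a b) u)⁻¹ *
        (speed S (fun w ↦ Γ (w, t)) (Icc a b) u)⁻¹ *
        S.θ (Γ (u, t)) (fstVelocity Γ a b T₀ (u, t)) *
        S.θ (Γ (u, t)) (fstVelocity Γ a b T₀ (u, t))) (Ico 0 T₀) t := by
  have h1 := hasDerivWithinAt_θ hnabla ht
    (mdifferentiableWithinAt_lift_snd (hγ.contMDiffOn_fstVelocity hab) hu ht)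
  refine h1.congr_deriv ?_
  rw [hγ.covAlong_fstVelocity hnabla hS hab hu ht, map_add,
    hγ.θ_covAlong_sndVelocity hnabla hab hu₀ hu ht, map_smul, S.θ_T, S.inner_J_J_self]
  have hs := hγ.speed_pos hab hu ht
  rw [hγ.inner_fstVelocity_self hab hu ht, smul_eq_mul]
  field_simp
  ring

/-- The flow preserves Legendrian curves. -/
theorem θ_fstVelocity (hnabla : IsTanakaConnection S nabla)
    (hS : IsSasakian S nabla) (hab : a < b) (hu₀ : u₀ ∈ Icc a b)
    (hγ₀ : IsLegendrian S γ₀ (Icc a b))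
    (hγ : IsExpandingFlow S nabla (fun u t ↦ Γ (u, t)) γ₀ a b u₀ T₀)
    (hu : u ∈ Icc a b) (ht : t ∈ Ico 0 T₀) :
    S.θ (Γ (u, t)) (fstVelocity Γ a b T₀ (u, t)) = 0 := by
  have hm : MapsTo (fun r : ℝ ↦ (u, r)) (Ico 0 T₀) (Icc a b ×ˢ Ico 0 T₀) := fun r hr ↦ ⟨hu, hr⟩
  -- The coefficient contains one of the two factors θ(X), so the quadratic equation is treated as
  -- linear.
  have hq : ContinuousOn (fun r ↦ -2 * (curvature S nabla (fun w ↦ Γ (w, r)) (Icc a b) u)⁻¹ *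
        (speed S (fun w ↦ Γ (w, r)) (Icc a b) u)⁻¹ *
        S.θ (Γ (u, r)) (fstVelocity Γ a b T₀ (u, r))) (Ico 0 T₀) :=
    (((continuousOn_const.mul (hγ.continuousOn_curvature_inv hab)).mul
      ((hγ.contDiffOn_speed hab).continuousOn.inv₀ fun p hp ↦ (hγ.speed_pos hab hp.1 hp.2).ne')).mul
      (S.contDiffOn_θ (hγ.contMDiffOn_fstVelocity hab)).continuousOn).comp
      (f := fun r : ℝ ↦ (u, r)) (by fun_prop) hm
  refine eq_zero_of_hasDerivWithinAt_mul (T := T₀)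
    (f := fun r ↦ S.θ (Γ (u, r)) (fstVelocity Γ a b T₀ (u, r))) (fun r hr ↦
    hγ.hasDerivWithinAt_θ_fstVelocity hnabla hS hab hu₀ hu hr) hq ?_ t ht
  have h0 : (0 : ℝ) ∈ Ico 0 T₀ := ⟨le_rfl, ht.1.trans_lt ht.2⟩
  -- Γ(·, 0) and γ₀ agree only on [a, b], which suffices for derivatives within [a, b].
  have hθ : ∀ (c c' : ℝ → M), (∀ w ∈ Icc a b, c w = c' w) →
      S.θ (c u) (velocity c (Icc a b) u) = S.θ (c' u) (velocity c' (Icc a b) u) := by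
    intro c c' h
    have h1 : mfderivWithin 𝓘(ℝ) (𝓡 3) c (Icc a b) u = mfderivWithin 𝓘(ℝ) (𝓡 3) c' (Icc a b) u :=
      mfderivWithin_congr h (h u hu)
    have h2 : ∀ (x y : M) (v : E3), x = y → S.θ x v = S.θ y v := by
      rintro x _ v rfl
      rfl
    exact (h2 _ _ _ (h u hu)).trans (congrArg (fun L : ℝ →L[ℝ] E3 ↦ S.θ (c' u) (L 1)) h1)
  rw [← hγ.velocity_eq hab hu h0]
  exact (hθ _ _ hγ.initial).trans (hγ₀ u hu)

theorem contMDiffOn_unitTangent (hab : a < b)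
    (hγ : IsExpandingFlow S nabla (fun u t ↦ Γ (u, t)) γ₀ a b u₀ T₀) :
    ContMDiffOn 𝓘(ℝ, ℝ × ℝ) ((𝓡 3).prod 𝓘(ℝ, E3)) ∞
      (fun p ↦ TotalSpace.mk' E3 (Γ p) (unitTangent S (fun w ↦ Γ (w, p.2)) (Icc a b) p.1 :
        TangentSpace (𝓡 3) (Γ p))) (Icc a b ×ˢ Ico 0 T₀) := by
  refine (ContMDiffOn.smul_lift ((hγ.contDiffOn_speed hab).inv fun p hp ↦
    (hγ.speed_pos hab hp.1 hp.2).ne') (hγ.contMDiffOn_fstVelocity hab)).congr fun p hp ↦ ?_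
  exact congrArg (TotalSpace.mk' E3 (Γ p)) (hγ.unitTangent_eq hab hp.1 hp.2)

theorem hasDerivWithinAt_inner_fstVelocity (hnabla : IsTanakaConnection S nabla)
    (hS : IsSasakian S nabla) (hab : a < b) (hu₀ : u₀ ∈ Icc a b)
    (hγ₀ : IsLegendrian S γ₀ (Icc a b))
    (hγ : IsExpandingFlow S nabla (fun u t ↦ Γ (u, t)) γ₀ a b u₀ T₀)
    (hu : u ∈ Icc a b) (ht : t ∈ Ico 0 T₀) :
    HasDerivWithinAt (fun r ↦ S.g.inner (Γ (u, r)) (fstVelocity Γ a b T₀ (u, r))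
      (fstVelocity Γ a b T₀ (u, r))) (2 * S.g.inner (Γ (u, t)) (fstVelocity Γ a b T₀ (u, t))
      (fstVelocity Γ a b T₀ (u, t))) (Ico 0 T₀) t := by
  have hX := mdifferentiableWithinAt_lift_snd (hγ.contMDiffOn_fstVelocity hab) hu ht
  have hY := mdifferentiableWithinAt_lift_fst (hγ.contMDiffOn_sndVelocity hab) hu ht
  have hU := mdifferentiableWithinAt_lift_fst (hγ.contMDiffOn_unitTangent hab) hu ht
  have hθ (w : ℝ) (hw : w ∈ Icc a b) := hγ.θ_fstVelocity hnabla hS hab hu₀ hγ₀ hw ht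
  have hθU (w : ℝ) (hw : w ∈ Icc a b) :
      S.θ (Γ (w, t)) (unitTangent S (fun w ↦ Γ (w, t)) (Icc a b) w) = 0 := by
    rw [hγ.unitTangent_eq hab hw ht, map_smul, hθ w hw, smul_zero]
  have hYU (w : ℝ) (hw : w ∈ Icc a b) : S.g.inner (Γ (w, t)) (sndVelocity Γ a b T₀ (w, t))
      (unitTangent S (fun w ↦ Γ (w, t)) (Icc a b) w) = 0 := by
    rw [hγ.sndVelocity_eq hw ht]
    simp only [map_sub, map_smul, sub_apply, smul_apply, S.inner_T_left,
      S.inner_J_self_of_horizontal (hθU w hw), hθU w hw, smul_zero, sub_zero]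
  have hs := hγ.speed_pos hab hu ht
  have huniq := uniqueDiffOn_Icc hab u hu
  -- Differentiating θ(τ) = 0 and g(Y, τ) = 0 in u: ∇_u τ is horizontal, and g(∇_u Y, τ) = -g(Y, ∇_u
  -- τ).
  have e1 := huniq.eq_deriv _ (hasDerivWithinAt_θ hnabla hu hU)
    ((hasDerivWithinAt_const u _ (0 : ℝ)).congr_of_mem hθU hu)
  have e2 := huniq.eq_deriv _ (hasDerivWithinAt_inner hnabla hu hY hU)
    ((hasDerivWithinAt_const u _ (0 : ℝ)).congr_of_mem hYU hu)
  have hk : S.g.inner (Γ (u, t)) (covAlong nabla (fun w ↦ Γ (w, t)) (Icc a b)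
        (unitTangent S (fun w ↦ Γ (w, t)) (Icc a b)) u)
      (S.J (Γ (u, t)) (unitTangent S (fun w ↦ Γ (w, t)) (Icc a b) u)) =
      speed S (fun w ↦ Γ (w, t)) (Icc a b) u *
        curvature S nabla (fun w ↦ Γ (w, t)) (Icc a b) u := by
    rw [curvature, map_smul, smul_apply, smul_eq_mul, mul_inv_cancel_left₀ hs.ne']
  have e3 : S.g.inner (Γ (u, t)) (sndVelocity Γ a b T₀ (u, t))
      (covAlong nabla (fun w ↦ Γ (w, t)) (Icc a b)
        (unitTangent S (fun w ↦ Γ (w, t)) (Icc a b)) u) =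
      -speed S (fun w ↦ Γ (w, t)) (Icc a b) u := by
    rw [S.g.symm, hγ.sndVelocity_eq hu ht, map_sub, map_smul, map_smul, hk, S.inner_T, e1,
      smul_zero, sub_zero, smul_eq_mul]
    have := hγ.curvature_ne_zero t ht u hu
    field_simp
  have e4 : S.g.inner (Γ (u, t)) (covAlong nabla (fun w ↦ Γ (w, t)) (Icc a b)
      (fun w ↦ sndVelocity Γ a b T₀ (w, t)) u) (fstVelocity Γ a b T₀ (u, t)) =
      speed S (fun w ↦ Γ (w, t)) (Icc a b) u ^ 2 := by
    rw [e3, hγ.unitTangent_eq hab hu ht, map_smul, smul_eq_mul] at e2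
    field_simp at e2
    linarith
  refine (hasDerivWithinAt_inner hnabla ht hX hX).congr_deriv ?_
  -- The torsion term is vertical, so its pairing with the horizontal X vanishes.
  rw [S.g.symm _ (fstVelocity Γ a b T₀ (u, t)) (covAlong _ _ _ _ _), ← two_mul,
    hγ.covAlong_fstVelocity hnabla hS hab hu ht, map_add, add_apply, e4, map_smul, smul_apply,
    S.inner_T_left, hθ u hu, smul_zero, add_zero,
    hγ.inner_fstVelocity_self hab hu ht]

theorem speed_eq_exp_mul (hnabla : IsTanakaConnection S nabla)
    (hS : IsSasakian S nabla) (hab : a < b) (hu₀ : u₀ ∈ Icc a b)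
    (hγ₀ : IsLegendrian S γ₀ (Icc a b))
    (hγ : IsExpandingFlow S nabla (fun u t ↦ Γ (u, t)) γ₀ a b u₀ T₀)
    (hu : u ∈ Icc a b) (ht : t ∈ Ico 0 T₀) :
    speed S (fun w ↦ Γ (w, t)) (Icc a b) u =
      Real.exp t * speed S (fun w ↦ Γ (w, 0)) (Icc a b) u := by
  have h0 : (0 : ℝ) ∈ Ico 0 T₀ := ⟨le_rfl, ht.1.trans_lt ht.2⟩
  have h := eq_exp_mul_of_hasDerivWithinAt (T := T₀) (c := 2) (fun r hr ↦
    hγ.hasDerivWithinAt_inner_fstVelocity hnabla hS hab hu₀ hγ₀ hu hr) t ht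
  rw [hγ.speed_eq hab hu ht, hγ.speed_eq hab hu h0, h, Real.sqrt_mul (Real.exp_pos _).le,
    two_mul, Real.exp_add, Real.sqrt_mul_self (Real.exp_pos _).le]

theorem curveLength_eq_exp_mul (hnabla : IsTanakaConnection S nabla)
    (hS : IsSasakian S nabla) (hab : a < b) (hu₀ : u₀ ∈ Icc a b)
    (hγ₀ : IsLegendrian S γ₀ (Icc a b))
    (hγ : IsExpandingFlow S nabla (fun u t ↦ Γ (u, t)) γ₀ a b u₀ T₀) (ht : t ∈ Ico 0 T₀) :
    curveLength S (fun w ↦ Γ (w, t)) a b =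
      Real.exp t * curveLength S (fun w ↦ Γ (w, 0)) a b := by
  rw [curveLength, curveLength, ← intervalIntegral.integral_const_mul]
  refine intervalIntegral.integral_congr fun u hu ↦ ?_
  rw [uIcc_of_le hab.le] at hu
  exact hγ.speed_eq_exp_mul hnabla hS hab hu₀ hγ₀ hu ht

theorem curveLength_pos (hab : a < b)
    (hγ : IsExpandingFlow S nabla (fun u t ↦ Γ (u, t)) γ₀ a b u₀ T₀) (ht : t ∈ Ico 0 T₀) :
    0 < curveLength S (fun w ↦ Γ (w, t)) a b := by
  have hm : MapsTo (fun w : ℝ ↦ (w, t)) (Icc a b) (Icc a b ×ˢ Ico 0 T₀) := fun w hw ↦ ⟨hw, ht⟩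
  have hc : ContinuousOn (speed S (fun w ↦ Γ (w, t)) (Icc a b)) (Icc a b) :=
    (hγ.contDiffOn_speed hab).continuousOn.comp (f := fun w : ℝ ↦ (w, t)) (by fun_prop) hm
  exact intervalIntegral.intervalIntegral_pos_of_pos_on (hc.intervalIntegrable_of_Icc hab.le)
    (fun u hu ↦ hγ.speed_pos hab (Ioo_subset_Icc_self hu) ht) hab

end IsExpandingFlow

end Flow

theorem proposition3p1 {M : Type*} [TopologicalSpace M] [ChartedSpace E3 M]
    [IsManifold (𝓡 3) ∞ M] (S : ContactSubRiemannian M)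
    (nabla : CovariantDerivative (𝓡 3) E3 (fun x : M ↦ TangentSpace (𝓡 3) x))
    (hnabla : IsTanakaConnection S nabla) (hS : IsSasakian S nabla)
    (a b u₀ T₀ : ℝ) (hab : a < b) (hu₀ : u₀ ∈ Set.Icc a b)
    (γ₀ : ℝ → M) (hγ₀ : IsLegendrian S γ₀ (Set.Icc a b))
    (γ : ℝ → ℝ → M) (hγ : IsExpandingFlow S nabla γ γ₀ a b u₀ T₀) :
    ∀ t ∈ Set.Ico 0 T₀,
      0 < curveLength S (fun u ↦ γ u t) a b ∧
      HasDerivWithinAt (fun r ↦ curveLength S (fun u ↦ γ u r) a b)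
        (curveLength S (fun u ↦ γ u t) a b) (Set.Ico 0 T₀) t ∧
      curveLength S (fun u ↦ γ u t) a b
        = Real.exp t * curveLength S (fun u ↦ γ u 0) a b := by
  intro t ht
  let Γ : ℝ × ℝ → M := fun p ↦ γ p.1 p.2
  have hΓ : IsExpandingFlow S nabla (fun u t ↦ Γ (u, t)) γ₀ a b u₀ T₀ := hγ
  have h (r : ℝ) (hr : r ∈ Ico 0 T₀) : curveLength S (fun u ↦ γ u r) a b
      = Real.exp r * curveLength S (fun u ↦ γ u 0) a b :=
    hΓ.curveLength_eq_exp_mul hnabla hS hab hu₀ hγ₀ hr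
  refine ⟨hΓ.curveLength_pos hab ht, ?_, h t ht⟩
  -- The derivative is read off from the closed form eʳ L₀, valid on all of [0, T₀).
  rw [h t ht]
  exact (((Real.hasDerivAt_exp t).mul_const _).hasDerivWithinAt).congr_of_mem h ht
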